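/- Let $p$ be a prime number, let $K$ be a finite extension of the field $\mathbb{Q}_p$ of $p$-adic numbers, and let $N/K$ be a fully ramified Galois extension with elementary abelian group $G=\mathrm{Gal}(N/K)\cong C_p^n$, where $n>1$. Let $v_N$ be the valuation of $N$, normalized so that $v_N(\pi_N)=1$ for a prime element $\pi_N$ of $N$, and for each integer $i\ge -1$ let $G_i=\{\sigma\in G : v_N((\sigma-1)\pi_N)\ge i+1\}$ be the $i$th ramification group. Suppose that $N/K$ has exactly one (lower) ramification break $b$, that is, $b$ is the only integer $i\ge -1$ with $G_i\supsetneq G_{i+1}$. Then every $\rho\in N$ with $v_N(\rho)\equiv b \pmod{p^n}$ generates a normal basis of $N$ over $K$, that is, the conjugates $\{\sigma\rho : \sigma\in G\}$ form a basis of $N$ as a vector space over $K$. -/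

import Mathlib

noncomputable section

namespace LocalNormalBasis

open Module

section Integers

variable (p : ℕ) [Fact p.Prime] (N : Type*) [Field N] [Algebra ℚ_[p] N]

/-- A `ℚ_[p]`-algebra is a `ℤ_[p]`-algebra by restriction of scalars. -/
instance (priority := 50) algebraPadicInt : Algebra ℤ_[p] N :=
  Algebra.compHom N (algebraMap ℤ_[p] ℚ_[p])

instance isScalarTower_padicInt : IsScalarTower ℤ_[p] ℚ_[p] N :=
  IsScalarTower.of_algebraMap_eq fun _ => rfl

/-- The ring of integers of a finite extension `N` of `ℚ_[p]`: the integral closure of `ℤ_[p]`. -/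
abbrev integers : Subalgebra ℤ_[p] N := integralClosure ℤ_[p] N

variable {N} in
theorem isIntegral_iff_spectralNorm_le_one [FiniteDimensional ℚ_[p] N] (x : N) :
    IsIntegral ℤ_[p] x ↔ spectralNorm ℚ_[p] N x ≤ 1 := by
  have hx : IsIntegral ℚ_[p] x := Algebra.IsIntegral.isIntegral x
  rw [spectralNorm, spectralValue_le_one_iff (minpoly.monic hx)]
  constructor
  · intro h n
    rw [minpoly.isIntegrallyClosed_eq_field_fractions' ℚ_[p] h, Polynomial.coeff_map]
    exact PadicInt.norm_le_one _
  · intro h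
    have hl : minpoly ℚ_[p] x ∈ Polynomial.lifts (algebraMap ℤ_[p] ℚ_[p]) := by
      rw [Polynomial.lifts_iff_coeff_lifts]
      exact fun n => ⟨⟨_, h n⟩, rfl⟩
    obtain ⟨q, hq, -, hm⟩ := Polynomial.lifts_and_degree_eq_and_monic hl (minpoly.monic hx)
    refine ⟨q, hm, ?_⟩
    have h0 : Polynomial.aeval x (q.map (algebraMap ℤ_[p] ℚ_[p])) = 0 := by
      rw [hq, minpoly.aeval]
    rwa [Polynomial.aeval_map_algebraMap] at h0

theorem integers_not_isField : ¬ IsField (integers p N) := by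
  intro h
  have hinj : Function.Injective (algebraMap ℤ_[p] (integers p N)) := by
    have h2 : Function.Injective (algebraMap ℤ_[p] N) := by
      rw [IsScalarTower.algebraMap_eq ℤ_[p] ℚ_[p] N]
      exact (algebraMap ℚ_[p] N).injective.comp (IsFractionRing.injective ℤ_[p] ℚ_[p])
    exact fun x y hxy => h2 (congrArg Subtype.val hxy)
  exact IsDiscreteValuationRing.not_isField ℤ_[p] (isField_of_isIntegral_of_isField hinj h)

variable [FiniteDimensional ℚ_[p] N]

instance integers_isFractionRing : IsFractionRing (integers p N) N :=
  integralClosure.isFractionRing_of_finite_extension ℚ_[p] N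

instance integers_isDedekindDomain : IsDedekindDomain (integers p N) :=
  integralClosure.isDedekindDomain ℤ_[p] ℚ_[p] N

instance integers_isLocalRing : IsLocalRing (integers p N) := by
  refine IsLocalRing.of_isUnit_or_isUnit_one_sub_self fun a => ?_
  have key : ∀ c : integers p N, 1 ≤ spectralNorm ℚ_[p] N (c : N) → IsUnit c := by
    intro c hc
    have hc0 : (c : N) ≠ 0 := by
      intro h
      rw [h, spectralNorm_zero] at hc
      linarith
    have hmul : spectralNorm ℚ_[p] N (c : N) * spectralNorm ℚ_[p] N (c : N)⁻¹ = 1 := by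
      have h := map_mul (spectralMulAlgNorm ℚ_[p] N) (c : N) (c : N)⁻¹
      rw [mul_inv_cancel₀ hc0, map_one] at h
      exact h.symm
    have hi : IsIntegral ℤ_[p] (c : N)⁻¹ := by
      rw [isIntegral_iff_spectralNorm_le_one]
      nlinarith [spectralNorm_nonneg (K := ℚ_[p]) (L := N) (c : N)⁻¹]
    exact IsUnit.of_mul_eq_one ⟨(c : N)⁻¹, hi⟩ (Subtype.ext (mul_inv_cancel₀ hc0))
  have hna : IsNonarchimedean (spectralNorm ℚ_[p] N) := isNonarchimedean_spectralNorm
  have h1 := hna (a : N) (1 - a : N)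
  rw [add_sub_cancel, spectralNorm_one, le_max_iff] at h1
  rcases h1 with h1 | h1
  · exact Or.inl (key a h1)
  · exact Or.inr (key (1 - a) h1)

instance integers_isDiscreteValuationRing : IsDiscreteValuationRing (integers p N) :=
  ((IsDiscreteValuationRing.TFAE (integers p N) (integers_not_isField p N)).out 0 2).mpr
    (integers_isDedekindDomain p N)

open Classical in
/-- The normalized additive valuation `v_N : N → ℤ ∪ {∞}` of a finite extension `N` of `ℚ_[p]`,
attached to the maximal ideal of its ring of integers (`exp (-k)` in Mathlib's multiplicative
adic valuation corresponds to `k`). -/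
def val (x : N) : WithTop ℤ :=
  if x = 0 then ⊤ else
    ((-WithZero.log ((IsDiscreteValuationRing.maximalIdeal (integers p N)).valuation N x) : ℤ) :
      WithTop ℤ)

end Integers

section Extension

variable (p : ℕ) [Fact p.Prime] (K N : Type*) [Field K] [Algebra ℚ_[p] K] [FiniteDimensional ℚ_[p] K]
  [Field N] [Algebra ℚ_[p] N] [FiniteDimensional ℚ_[p] N] [Algebra K N]

/-- `N / K` is fully ramified: its ramification index, the value of `v_N` on a prime element
of `K`, is `[N : K]`. -/
def IsFullyRamified : Prop :=
  ∀ ϖ : K, val p K ϖ = 1 → val p N (algebraMap K N ϖ) = (finrank K N : ℤ)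

variable {N}

/-- `G_i = {σ ∈ Gal(N/K) : v_N((σ - 1) π_N) ≥ i + 1}`, for a prime element `π` of `N`. -/
def ramificationGroup (π : N) (i : ℤ) : Set Gal(N/K) :=
  {σ | ((i + 1 : ℤ) : WithTop ℤ) ≤ val p N (σ π - π)}

/-- The lower ramification breaks: the integers `b ≥ -1` with `G_b ⊋ G_{b+1}`. -/
def lowerBreaks (π : N) : Set ℤ :=
  {b | -1 ≤ b ∧ ramificationGroup p K π (b + 1) ⊂ ramificationGroup p K π b}

end Extension

/-- The conjugates of `ρ` under `Gal(N/K)` form a basis of `N` over `K`. -/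
def GeneratesNormalBasis (K : Type*) {N : Type*} [Field K] [Field N] [Algebra K N] (ρ : N) : Prop :=
  LinearIndependent K (fun σ : Gal(N/K) => σ ρ) ∧
    Submodule.span K (Set.range fun σ : Gal(N/K) => σ ρ) = ⊤

end LocalNormalBasis

end

/-!
Through the trace form, `ρ` generates a normal basis unless it is orthogonal to a nonzero
`Gal(N/K)`-stable subspace `W` of `N`. Put `d = [N : K] = p ^ n`. With a single break `b`, the
different and the orthogonality relations for powers of a uniformizer show that
`v(Tr x) = v(x) + (d - 1) b` whenever `v(x) ≡ b` modulo `d`. So `Tr (ρ z) ≠ 0` whenever `d ∣ v(z)`,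
and it suffices to find such a `z` in `W`.

Summing the conjugates of a nonzero element of `W` over the kernel of a suitable character
`G → ℤ/p` gives a nonzero element of `W` in `K` or in a subextension `L` of degree `p`, which again
has break `b`. If
`p ∤ b`, every application of `τ - 1` on `L` raises the valuation of an element of valuation prime
to `p` by exactly `b`, so one eventually reaches an element of `W ∩ L` of valuation divisible by
`p` in `L`, hence by `d` in `N`.

Finally `p ∤ b` because `n > 1`: if `p ∣ b`, the trace formula computes `v(p)` both from a
subextension `N / E` of degree `p` and from a subextension `L / K` of degree `p`, and the two
values, `(p - 1) b` and `[N : L] (p - 1) b`, cannot agree as `v(p) > 0`.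
-/

namespace LocalNormalBasis

open Module

section AddValuation

variable {L : Type*} [Field L] {v : AddValuation L (WithTop ℤ)} {x y : L} {c d : ℤ}

theorem ne_zero_of_map_eq_coe (hx : v x = c) : x ≠ 0 :=
  v.ne_top_iff.1 (hx ▸ WithTop.coe_ne_top)

theorem exists_map_eq_coe (v : AddValuation L (WithTop ℤ)) (hx : x ≠ 0) : ∃ c : ℤ, v x = c :=
  (WithTop.ne_top_iff_exists.1 (v.ne_top_iff.2 hx)).imp fun _ h => h.symm

theorem map_mul_eq_coe (hx : v x = c) (hy : v y = d) : v (x * y) = (c + d : ℤ) := by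
  rw [v.map_mul, hx, hy, WithTop.coe_add]

theorem map_pow_eq_coe (hx : v x = c) (k : ℕ) : v (x ^ k) = (k * c : ℤ) := by
  rw [v.map_pow, hx, ← nsmul_eq_mul, WithTop.coe_nsmul]

theorem map_eq_coe_of_mul (hy : v y = d) (hxy : v (x * y) = c) : v x = (c - d : ℤ) := by
  obtain ⟨a, ha⟩ := exists_map_eq_coe v (left_ne_zero_of_mul (ne_zero_of_map_eq_coe hxy))
  rw [map_mul_eq_coe ha hy, WithTop.coe_inj] at hxy
  rw [ha, ← hxy, add_sub_cancel_right]

theorem map_div_eq_coe (hx : v x = c) (hy : v y = d) : v (x / y) = (c - d : ℤ) :=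
  map_eq_coe_of_mul hy (by rwa [div_mul_cancel₀ _ (ne_zero_of_map_eq_coe hy)])

theorem map_zpow_eq_coe (hx : v x = c) (k : ℤ) : v (x ^ k) = (k * c : ℤ) := by
  obtain ⟨m, rfl | rfl⟩ := k.eq_nat_or_neg
  · exact_mod_cast map_pow_eq_coe hx m
  · have h := map_div_eq_coe v.map_one (map_pow_eq_coe hx m)
    simpa using h

theorem map_prod_eq_coe {ι : Type*} {s : Finset ι} {f : ι → L} (h : ∀ i ∈ s, v (f i) = c) :
    v (∏ i ∈ s, f i) = (s.card * c : ℤ) := by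
  classical
  induction s using Finset.induction_on with
  | empty => simp
  | insert i s hi ih =>
    rw [Finset.forall_mem_insert] at h
    rw [Finset.prod_insert hi, map_mul_eq_coe h.1 (ih h.2), Finset.card_insert_of_notMem hi]
    exact WithTop.coe_inj.2 (by push_cast; ring)

theorem map_sum_eq_of_forall_lt {ι : Type*} {s : Finset ι} {f : ι → L} {i : ι} (hi : i ∈ s)
    (hc : v (f i) = c) (hlt : ∀ j ∈ s, j ≠ i → c < v (f j)) : v (∑ j ∈ s, f j) = c := by
  classical
  rw [← Finset.add_sum_erase s f hi, ← hc]
  refine v.map_eq_of_lt_sub ?_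
  rw [add_sub_cancel_left]
  exact v.map_lt_sum' (hc ▸ WithTop.coe_lt_top c) fun j hj =>
    hc ▸ hlt j (Finset.mem_of_mem_erase hj) (Finset.ne_of_mem_erase hj)

theorem zero_le_map_natCast (v : AddValuation L (WithTop ℤ)) (k : ℕ) : 0 ≤ v (k : L) := by
  rw [← nsmul_one, ← Finset.card_range k, ← Finset.sum_const]
  exact v.map_le_sum fun _ _ => v.map_one.ge

theorem map_eq_zero_of_pos_map_sub (h : 0 < v (x - y)) (hy : v y = 0) : v x = 0 := by
  rw [← hy]
  exact v.map_eq_of_lt_sub (hy ▸ h)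

theorem map_natCast_eq_zero {p j : ℕ} [hp : Fact p.Prime] (hvp : 0 < v (p : L)) (hj : ¬ p ∣ j) :
    v (j : L) = 0 := by
  obtain ⟨k, -, hk⟩ := Nat.exists_mul_mod_eq_one_of_coprime
    ((Nat.Prime.coprime_iff_not_dvd hp.out).2 hj).symm hp.out.one_lt
  have hjk : v ((j : L) * k) = 0 := by
    refine map_eq_zero_of_pos_map_sub (y := 1) ?_ v.map_one
    have hsub : (j : L) * k - 1 = p * ((j * k / p : ℕ) : L) := by
      have hdiv := congrArg (Nat.cast : ℕ → L) (Nat.div_add_mod (j * k) p)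
      rw [hk] at hdiv
      push_cast at hdiv
      exact sub_eq_of_eq_add hdiv.symm
    rw [hsub, v.map_mul]
    exact add_pos_of_pos_of_nonneg hvp (zero_le_map_natCast v _)
  rw [v.map_mul] at hjk
  exact ((add_eq_zero_iff_of_nonneg (zero_le_map_natCast v _) (zero_le_map_natCast v _)).1 hjk).1

theorem zero_le_map_geom_sum (hx : v x = 0) (j : ℕ) : 0 ≤ v (∑ i ∈ Finset.range j, x ^ i) :=
  v.map_le_sum fun i _ => by rw [v.map_pow, hx, nsmul_zero]

theorem map_geom_sum_eq_zero {p j : ℕ} [Fact p.Prime] (hvp : 0 < v (p : L)) (hj : ¬ p ∣ j)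
    (hx : 0 < v (x - 1)) : v (∑ i ∈ Finset.range j, x ^ i) = 0 := by
  have hx0 : v x = 0 := map_eq_zero_of_pos_map_sub hx v.map_one
  refine map_eq_zero_of_pos_map_sub ?_ (map_natCast_eq_zero hvp hj)
  rw [show (j : L) = ∑ _i ∈ Finset.range j, 1 by simp, ← Finset.sum_sub_distrib]
  refine v.map_lt_sum WithTop.zero_ne_top fun i _ => ?_
  rw [← mul_geom_sum, v.map_mul]
  exact add_pos_of_pos_of_nonneg hx (zero_le_map_geom_sum hx0 i)

end AddValuation

section Galois

open Polynomial

variable {K N : Type*} [Field K] [Field N] [Algebra K N]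

theorem aeval_map_restrictNormal (L : IntermediateField K N) [Normal K L] (τ : Gal(N/K))
    (f : L[X]) (x : N) :
    aeval (τ x) (f.map (τ.restrictNormal L : L →+* L)) = τ (aeval x f) := by
  have hcomp : (algebraMap L N).comp (τ.restrictNormal L : L →+* L) =
      (τ : N →+* N).comp (algebraMap L N) :=
    RingHom.ext (τ.restrictNormal_commutes L)
  rw [aeval_def, eval₂_map, hcomp, aeval_def]
  exact (hom_eval₂ f (algebraMap L N) (τ : N →+* N) x).symm

theorem sum_apply_mem_fixedField (H : Subgroup Gal(N/K)) [Fintype H] (y : N) :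
    ∑ σ : H, (σ : Gal(N/K)) y ∈ IntermediateField.fixedField H := fun τ => by
  change (τ : Gal(N/K)) (∑ σ : H, (σ : Gal(N/K)) y) = _
  rw [map_sum]
  exact Equiv.sum_comp (Equiv.mulLeft τ) fun σ : H => (σ : Gal(N/K)) y

theorem gal_aeval_sub {α : N} (hα : α ≠ 0) (τ : Gal(N/K)) (P : K[X]) :
    τ (aeval α P) - aeval α P = ∑ j ∈ P.support, algebraMap K N (P.coeff j) * α ^ j *
      ((τ α / α - 1) * ∑ i ∈ Finset.range j, (τ α / α) ^ i) := by
  rw [← aeval_algHom_apply, aeval_def, eval₂_eq_sum, sum_def, aeval_def, eval₂_eq_sum, sum_def,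
    ← Finset.sum_sub_distrib]
  refine Finset.sum_congr rfl fun j _ => ?_
  rw [mul_geom_sum, mul_assoc, mul_sub_one, div_pow, mul_div_cancel₀ _ (pow_ne_zero j hα), mul_sub]

variable [FiniteDimensional K N] [IsGalois K N]

theorem card_univ_gal : (Finset.univ : Finset Gal(N/K)).card = finrank K N := by
  rw [Finset.card_univ, ← Nat.card_eq_fintype_card, IsGalois.card_aut_eq_finrank]

theorem exists_intermediateField_finrank_eq {p n m : ℕ} [Fact p.Prime]
    (hn : finrank K N = p ^ n) (hm : m ≤ n) : ∃ E : IntermediateField K N, finrank E N = p ^ m := by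
  obtain ⟨H, hH⟩ := Sylow.exists_subgroup_card_pow_prime p (G := Gal(N/K)) (n := m)
    (by rw [IsGalois.card_aut_eq_finrank, hn]; exact pow_dvd_pow p hm)
  exact ⟨IntermediateField.fixedField H, by rw [IntermediateField.finrank_fixedField_eq_card, hH]⟩

variable (K) in
theorem exists_monic_aeval_eq_prod_sub (α : N) :
    ∃ f : K[X], f.Monic ∧ f.degree = finrank K N ∧ ∀ x, aeval x f = ∏ σ : Gal(N/K), (x - σ α) := by
  obtain ⟨f, hf, hdeg, hmonic⟩ := lifts_and_degree_eq_and_monic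
    (Algebra.IsInvariant.charpoly_mem_lifts K N Gal(N/K) α) (MulSemiringAction.monic_charpoly _ α)
  refine ⟨f, hmonic, ?_, fun x => ?_⟩
  · rw [hdeg, MulSemiringAction.charpoly_eq, degree_prod]
    simp only [degree_X_sub_C, Finset.sum_const, nsmul_one]
    rw [card_univ_gal]
  · rw [← eval_map_algebraMap, hf, MulSemiringAction.charpoly_eq, eval_prod]
    simp only [eval_sub, eval_X, eval_C, AlgEquiv.smul_def]

theorem trace_aeval_div_prod_sub [DecidableEq Gal(N/K)] {α : N}
    (hα : Function.Injective fun σ : Gal(N/K) => σ α) {P : K[X]} (hP : P.degree < finrank K N) :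
    Algebra.trace K N (aeval α P / ∏ σ ∈ Finset.univ.erase (1 : Gal(N/K)), (α - σ α)) =
      P.coeff (finrank K N - 1) := by
  have hcard := card_univ_gal (K := K) (N := N)
  apply (algebraMap K N).injective
  rw [trace_eq_sum_automorphisms, ← coeff_map, ← hcard,
    Lagrange.coeff_eq_sum hα.injOn (degree_map_le.trans_lt (hcard ▸ hP))]
  refine Finset.sum_congr rfl fun τ _ => ?_
  rw [map_div₀, map_prod, ← aeval_algHom_apply, eval_map_algebraMap]
  congr 1
  refine Finset.prod_bij' (fun σ _ => τ * σ) (fun σ _ => τ⁻¹ * σ) ?_ ?_ ?_ ?_ ?_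
  · simp
  · simp [inv_mul_eq_one, eq_comm]
  · simp
  · simp
  · simp [AlgEquiv.mul_apply]

theorem generatesNormalBasis_of_forall_trace {ρ : N}
    (h : ∀ y, (∀ σ : Gal(N/K), Algebra.trace K N (ρ * σ y) = 0) → y = 0) :
    GeneratesNormalBasis K ρ := by
  have htop : Submodule.span K (Set.range fun σ : Gal(N/K) => σ ρ) = ⊤ := by
    by_contra hne
    obtain ⟨f, hf, hle⟩ := Submodule.exists_le_ker_of_lt_top _ (lt_top_iff_ne_top.2 hne)
    obtain ⟨y, rfl⟩ := (Algebra.traceForm K N).toDual (traceForm_nondegenerate K N) |>.surjective f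
    refine hf ?_
    rw [h y ?_, map_zero]
    intro σ
    have hσ : Algebra.trace K N (y * σ⁻¹ ρ) = 0 := hle (Submodule.subset_span ⟨σ⁻¹, rfl⟩)
    rw [← hσ, ← Algebra.trace_eq_of_algEquiv σ (y * _), map_mul σ, ← AlgEquiv.mul_apply,
      mul_inv_cancel, AlgEquiv.one_apply, mul_comm]
  exact ⟨linearIndependent_of_top_le_span_of_card_eq_finrank htop.ge
    (by rw [← Nat.card_eq_fintype_card, IsGalois.card_aut_eq_finrank]), htop⟩

end Galois

section DotProduct

open Finset

variable {p n : ℕ} [hp : Fact p.Prime]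

theorem card_dotProduct_eq_zero {a : Fin n → ZMod p} (ha : a ≠ 0) :
    #{l : Fin n → ZMod p | l ⬝ᵥ a = 0} * p = p ^ n := by
  let f : (Fin n → ZMod p) →+ ZMod p := (dotProductEquiv (ZMod p) (Fin n) a).toAddMonoidHom
  have hf : Function.Surjective f :=
    LinearMap.surjective ((dotProductEquiv (ZMod p) (Fin n)).map_ne_zero_iff.2 ha)
  have hcard := f.ker.card_mul_index
  rw [AddSubgroup.index_ker, AddMonoidHom.range_eq_top.2 hf, AddSubgroup.card_top,
    Nat.card_zmod, Nat.card_fun, Nat.card_zmod, Nat.card_fin] at hcard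
  rw [← hcard, ← Fintype.card_subtype, ← Nat.card_eq_fintype_card]
  simp only [dotProduct_comm _ a]
  rfl

theorem exists_sum_dotProduct_eq_zero_ne_zero {M : Type*} [AddCommGroup M] [IsAddTorsionFree M]
    {f : (Fin n → ZMod p) → M} (hf : f 0 ≠ 0) :
    ∃ l : Fin n → ZMod p, ∑ a with l ⬝ᵥ a = 0, f a ≠ 0 := by
  -- Otherwise double counting the pairs `(l, a)` with `l ⬝ᵥ a = 0` isolates `f 0`, the only value
  -- that occurs for every `l`.
  by_contra! h
  have hcount : ∀ a : Fin n → ZMod p, (p * #{l : Fin n → ZMod p | l ⬝ᵥ a = 0}) • f a =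
      p ^ n • f a + if a = 0 then ((p - 1) * p ^ n) • f a else 0 := by
    intro a
    split_ifs with ha
    · subst ha
      simp only [dotProduct_zero, filter_true, card_univ, Fintype.card_fun, ZMod.card,
        Fintype.card_fin]
      rw [← add_smul, ← one_add_mul, Nat.add_sub_cancel' hp.out.one_le]
    · rw [mul_comm, card_dotProduct_eq_zero ha, add_zero]
  have hdouble : ∑ a, (p * #{l : Fin n → ZMod p | l ⬝ᵥ a = 0}) • f a = 0 := by
    calc ∑ a, (p * #{l : Fin n → ZMod p | l ⬝ᵥ a = 0}) • f a
        = p • ∑ l : Fin n → ZMod p, ∑ a with l ⬝ᵥ a = 0, f a := by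
          simp only [sum_filter]
          rw [sum_comm, smul_sum]
          simp only [← sum_filter, sum_const, mul_smul]
      _ = 0 := by simp only [h, sum_const_zero, smul_zero]
  have hzero : ∑ a, f a = 0 := by simpa using h 0
  simp only [hcount, sum_add_distrib, ← smul_sum, hzero, smul_zero, zero_add, sum_ite_eq',
    mem_univ, if_true] at hdouble
  exact (smul_ne_zero (mul_ne_zero (Nat.sub_ne_zero_of_lt hp.out.one_lt)
    (pow_ne_zero n hp.out.ne_zero)) hf) hdouble

theorem exists_hom_sum_ker_ne_zero {G M : Type*} [Group G] [Fintype G] [AddCommGroup M]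
    [IsAddTorsionFree M] (φ : G ≃* Multiplicative (Fin n → ZMod p)) {f : G → M} (hf : f 1 ≠ 0) :
    ∃ χ : G →* Multiplicative (ZMod p), ∑ g : χ.ker, f g ≠ 0 := by
  obtain ⟨l, hl⟩ := exists_sum_dotProduct_eq_zero_ne_zero (f := fun a => f (φ.symm (.ofAdd a)))
    (by rwa [ofAdd_zero, map_one])
  let χ : G →* Multiplicative (ZMod p) :=
    (AddMonoidHom.toMultiplicative (dotProductEquiv (ZMod p) (Fin n) l).toAddMonoidHom).comp φ
  refine ⟨χ, ?_⟩
  rw [← sum_subtype {g | χ g = 1} (fun g => by simp [MonoidHom.mem_ker]) f, sum_filter,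
    ← (Multiplicative.ofAdd.trans φ.symm.toEquiv).sum_comp, ← sum_filter]
  convert hl using 3
  · simp [χ]
  · rfl

end DotProduct

section TotallyRamified

open Polynomial

/-- `L / F` is totally ramified with uniformizer `π`, for a valuation `v` that is `e` times the
normalized valuation of `L`. The factor `e` allows `v` to be the restriction to `L` of the
normalized valuation of a larger field. -/
structure IsTotallyRamified (F : Type*) {L : Type*} [Field F] [Field L] [Algebra F L]
    (v : AddValuation L (WithTop ℤ)) (π : L) (e : ℤ) : Prop where
  pos : 0 < e
  map_uniformizer : v π = e
  exists_map_algebraMap : ∀ a : F, a ≠ 0 →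
    ∃ t : ℤ, v (algebraMap F L a) = (e * (finrank F L * t) : ℤ)

namespace IsTotallyRamified

variable {F L : Type*} [Field F] [Field L] [Algebra F L]
  {v : AddValuation L (WithTop ℤ)} {π : L} {e : ℤ} (h : IsTotallyRamified F v π e)

include h

theorem exists_map_monomial {a : F} (ha : a ≠ 0) (i : ℕ) :
    ∃ m : ℤ, v (algebraMap F L a * π ^ i) = (e * m : ℤ) ∧ i ≡ m [ZMOD finrank F L] := by
  obtain ⟨t, ht⟩ := h.exists_map_algebraMap a ha
  refine ⟨finrank F L * t + i, ?_, ?_⟩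
  · rw [map_mul_eq_coe ht (map_pow_eq_coe h.map_uniformizer i)]
    ring_nf
  · exact (Int.modEq_iff_add_fac.2 ⟨t, by ring⟩)

theorem exists_dominant_monomial {P : F[X]} (hP : P ≠ 0) (hd : P.degree < finrank F L) :
    ∃ (i : ℕ) (m : ℤ), v (aeval π P) = (e * m : ℤ) ∧ i < finrank F L ∧ i ≡ m [ZMOD finrank F L] ∧
      v (algebraMap F L (P.coeff i) * π ^ i) = (e * m : ℤ) ∧
      ∀ j, j ≠ i → ((e * m : ℤ) : WithTop ℤ) < v (algebraMap F L (P.coeff j) * π ^ j) := by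
  have hlt : ∀ j ∈ P.support, j < finrank F L := fun j hj =>
    WithBot.coe_lt_coe.1 ((le_degree_of_mem_supp j hj).trans_lt hd)
  choose! m hm hmod using fun (j : ℕ) (hj : j ∈ P.support) =>
    h.exists_map_monomial (mem_support_iff.1 hj) j
  obtain ⟨i, hi, hmin⟩ := P.support.exists_min_image m (support_nonempty.2 hP)
  have hlt' : ∀ j ∈ P.support, j ≠ i →
      ((e * m i : ℤ) : WithTop ℤ) < v (algebraMap F L (P.coeff j) * π ^ j) := by
    intro j hj hji
    have hne : m i ≠ m j := fun hij => hji <| (Int.natCast_modEq_iff.1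
      ((hmod j hj).trans (hij ▸ (hmod i hi).symm))).eq_of_lt_of_lt (hlt j hj) (hlt i hi)
    rw [hm j hj, WithTop.coe_lt_coe]
    exact mul_lt_mul_of_pos_left ((hmin j hj).lt_of_ne hne) h.pos
  refine ⟨i, m i, ?_, hlt i hi, hmod i hi, hm i hi, fun j hji => ?_⟩
  · rw [aeval_def, eval₂_eq_sum, sum_def]
    exact map_sum_eq_of_forall_lt hi (hm i hi) hlt'
  · by_cases hj : j ∈ P.support
    · exact hlt' j hj hji
    · rw [notMem_support_iff.1 hj, map_zero, zero_mul, v.map_zero]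
      exact WithTop.coe_lt_top _

theorem exists_dominant_monomial_of_map_eq {P : F[X]} (hd : P.degree < finrank F L) {m : ℤ}
    (hm : v (aeval π P) = (e * m : ℤ)) :
    ∃ i : ℕ, i < finrank F L ∧ i ≡ m [ZMOD finrank F L] ∧
      v (algebraMap F L (P.coeff i) * π ^ i) = (e * m : ℤ) ∧
      ∀ j, j ≠ i → ((e * m : ℤ) : WithTop ℤ) < v (algebraMap F L (P.coeff j) * π ^ j) := by
  have hP : P ≠ 0 := by
    rintro rfl
    exact ne_zero_of_map_eq_coe hm (map_zero _)
  obtain ⟨i, k, hk, hi⟩ := h.exists_dominant_monomial hP hd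
  obtain rfl : k = m := mul_left_cancel₀ h.pos.ne' (WithTop.coe_inj.1 (hk.symm.trans hm))
  exact ⟨i, hi⟩

theorem map_coeff_eq {P : F[X]} (hd : P.degree < finrank F L) {m : ℤ}
    (hm : v (aeval π P) = (e * m : ℤ)) {i : ℕ} (hi : i < finrank F L)
    (him : i ≡ m [ZMOD finrank F L]) : v (algebraMap F L (P.coeff i)) = (e * (m - i) : ℤ) := by
  obtain ⟨k, hk, hkm, hv, -⟩ := h.exists_dominant_monomial_of_map_eq hd hm
  obtain rfl : k = i := (Int.natCast_modEq_iff.1 (hkm.trans him.symm)).eq_of_lt_of_lt hk hi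
  rw [map_eq_coe_of_mul (map_pow_eq_coe h.map_uniformizer k) hv]
  ring_nf

theorem exists_aeval_eq [FiniteDimensional F L] (x : L) :
    ∃ P : F[X], P.degree < finrank F L ∧ aeval π P = x := by
  let f : degreeLT F (finrank F L) →ₗ[F] L := (aeval π).toLinearMap ∘ₗ Submodule.subtype _
  have hf : Function.Injective f := by
    refine (injective_iff_map_eq_zero f).2 fun P hP => ?_
    by_contra hP0
    obtain ⟨-, m, hm, -⟩ := h.exists_dominant_monomial (fun h0 => hP0 (Subtype.ext h0))
      (mem_degreeLT.1 P.2)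
    exact ne_zero_of_map_eq_coe hm hP
  have : FiniteDimensional F (degreeLT F (finrank F L)) :=
    (degreeLTEquiv F (finrank F L)).symm.finiteDimensional
  have hrank : finrank F (degreeLT F (finrank F L)) = finrank F L := by
    rw [(degreeLTEquiv F (finrank F L)).finrank_eq, finrank_fin_fun]
  obtain ⟨P, hP⟩ := (LinearMap.injective_iff_surjective_of_finrank_eq_finrank hrank).1 hf x
  exact ⟨P, mem_degreeLT.1 P.2, hP⟩

theorem exists_map_eq [FiniteDimensional F L] {x : L} (hx : x ≠ 0) :
    ∃ m : ℤ, v x = (e * m : ℤ) := by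
  obtain ⟨P, hd, rfl⟩ := h.exists_aeval_eq x
  obtain ⟨-, m, hm, -⟩ := h.exists_dominant_monomial (by rintro rfl; exact hx (map_zero _)) hd
  exact ⟨m, hm⟩

theorem gal_injective [FiniteDimensional F L] : Function.Injective fun σ : Gal(L/F) => σ π := by
  intro σ τ hστ
  ext x
  obtain ⟨P, -, rfl⟩ := h.exists_aeval_eq x
  rw [← aeval_algHom_apply, ← aeval_algHom_apply, show σ π = τ π from hστ]

variable [FiniteDimensional F L] {b : ℤ} {τ : Gal(L/F)} {p : ℕ} [Fact p.Prime]

theorem map_gal_sub (hp : finrank F L = p) (hvp : 0 < v (p : L)) (hb : 0 < b)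
    (hτ : v (τ π - π) = (e * (b + 1) : ℤ)) {y : L} {m : ℤ} (hy : v y = (e * m : ℤ))
    (hm : ¬ (p : ℤ) ∣ m) : v (τ y - y) = (e * (m + b) : ℤ) := by
  obtain ⟨P, hd, rfl⟩ := h.exists_aeval_eq y
  obtain ⟨i, -, him, hvi, hlt⟩ := h.exists_dominant_monomial_of_map_eq hd hy
  have hπ : π ≠ 0 := ne_zero_of_map_eq_coe h.map_uniformizer
  have hw : v (τ π / π - 1) = (e * b : ℤ) := by
    rw [div_sub_one hπ, map_div_eq_coe hτ h.map_uniformizer]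
    ring_nf
  have hw0 : 0 < v (τ π / π - 1) := by
    rw [hw]
    exact WithTop.coe_lt_coe.2 (mul_pos h.pos hb)
  have hpi : ¬ p ∣ i := fun hpi =>
    hm ((hp ▸ him.dvd_iff).1 (Int.natCast_dvd_natCast.2 hpi))
  have hiP : i ∈ P.support :=
    mem_support_iff.2 fun h0 => ne_zero_of_map_eq_coe hvi (by rw [h0, map_zero, zero_mul])
  rw [gal_aeval_sub hπ τ P]
  refine map_sum_eq_of_forall_lt hiP ?_ fun j _ hji => ?_
  · rw [map_mul_eq_coe hvi (map_mul_eq_coe hw (map_geom_sum_eq_zero hvp hpi hw0))]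
    ring_nf
  · rw [← mul_assoc, v.map_mul, v.map_mul _ (τ π / π - 1), hw, mul_add, WithTop.coe_add]
    exact (WithTop.add_lt_add_right WithTop.coe_ne_top (hlt j hji)).trans_le
      (le_add_of_nonneg_right (zero_le_map_geom_sum (map_eq_zero_of_pos_map_sub hw0 v.map_one) j))

theorem exists_mem_map_eq_prime_mul_of_stable (hp : finrank F L = p) (hvp : 0 < v (p : L))
    (hb : 0 < b) (hpb : ¬ (p : ℤ) ∣ b) (hτ : v (τ π - π) = (e * (b + 1) : ℤ))
    {W : Submodule F L} (hW : ∀ y ∈ W, τ y ∈ W) (hW0 : W ≠ ⊥) :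
    ∃ z ∈ W, ∃ m : ℤ, v z = (e * (p * m) : ℤ) := by
  -- `k` counts the applications of `τ - 1` needed to reach a valuation divisible by `p`.
  have hstep : ∀ (k : ℕ) (m : ℤ) (y : L), y ∈ W → v y = (e * m : ℤ) → (p : ℤ) ∣ m + k * b →
      ∃ z ∈ W, ∃ m : ℤ, v z = (e * (p * m) : ℤ) := by
    intro k
    induction k with
    | zero =>
      rintro m y hy hv hm
      obtain ⟨t, rfl⟩ : (p : ℤ) ∣ m := by simpa using hm
      exact ⟨y, hy, t, hv⟩
    | succ k ih =>
      rintro m y hy hv hm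
      by_cases hpm : (p : ℤ) ∣ m
      · obtain ⟨t, rfl⟩ := hpm
        exact ⟨y, hy, t, hv⟩
      · refine ih (m + b) (τ y - y) (W.sub_mem (hW y hy) hy)
          (h.map_gal_sub hp hvp hb hτ hv hpm) ?_
        convert hm using 1
        push_cast
        ring
  obtain ⟨y, hy, hy0⟩ := W.exists_mem_ne_zero_of_ne_bot hW0
  obtain ⟨m, hm⟩ := h.exists_map_eq hy0
  refine hstep (-m / b : ZMod p).val m y hy hm ?_
  have hb0 : (b : ZMod p) ≠ 0 := fun h0 => hpb ((ZMod.intCast_zmod_eq_zero_iff_dvd b p).1 h0)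
  rw [← ZMod.intCast_zmod_eq_zero_iff_dvd]
  push_cast
  rw [ZMod.natCast_zmod_val, div_mul_cancel₀ _ hb0, add_neg_cancel]

end IsTotallyRamified

end TotallyRamified

section SingleBreak

open Polynomial

/-- `v` is the normalized valuation of a totally ramified extension `N / K`, invariant under
`Gal(N/K)`, with uniformizer `π`, and `b` is the only lower ramification break: every nontrivial
`σ ∈ Gal(N/K)` satisfies `v (σ π - π) = b + 1`. -/
structure HasSingleBreak (K : Type*) {N : Type*} [Field K] [Field N] [Algebra K N]
    (v : AddValuation N (WithTop ℤ)) (π : N) (b : ℤ) : Prop extends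
    IsTotallyRamified K v π 1 where
  map_gal : ∀ (σ : Gal(N/K)) (x : N), v (σ x) = v x
  map_gal_sub : ∀ σ : Gal(N/K), σ ≠ 1 → v (σ π - π) = (b + 1 : ℤ)

namespace HasSingleBreak

variable {K N : Type*} [Field K] [Field N] [Algebra K N] {v : AddValuation N (WithTop ℤ)} {π : N}
  {b c : ℤ}

theorem map_gal_sub_gal (S : HasSingleBreak K v π b) {σ τ : Gal(N/K)} (h : σ ≠ τ) :
    v (σ π - τ π) = (b + 1 : ℤ) := by
  rw [← S.map_gal_sub (τ⁻¹ * σ) (by rwa [Ne, inv_mul_eq_one, eq_comm]), ← S.map_gal τ (_ - π),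
    map_sub τ, ← AlgEquiv.mul_apply, mul_inv_cancel_left]

theorem break_nonneg (S : HasSingleBreak K v π b) {σ : Gal(N/K)} (hσ : σ ≠ 1) : 0 ≤ b := by
  have h : min (v (σ π)) (v π) ≤ v (σ π - π) := v.map_sub _ _
  rw [S.map_gal, min_self, S.map_uniformizer, S.map_gal_sub σ hσ, WithTop.coe_le_coe] at h
  exact le_of_add_le_add_right (by rwa [zero_add])

variable [FiniteDimensional K N] [IsGalois K N]

theorem map_trace (S : HasSingleBreak K v π b) {ρ : N} (hρ : v ρ = c)
    (hc : c ≡ b [ZMOD finrank K N]) :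
    v (algebraMap K N (Algebra.trace K N ρ)) = (c + (finrank K N - 1) * b : ℤ) := by
  classical
  set d : ℤ := (finrank K N : ℤ)
  have hd : ((finrank K N - 1 : ℕ) : ℤ) = d - 1 := Nat.cast_pred finrank_pos
  set D := ∏ σ ∈ Finset.univ.erase (1 : Gal(N/K)), (π - σ π)
  have hD : v D = ((d - 1) * (b + 1) : ℤ) := by
    have hsub : ∀ σ ∈ Finset.univ.erase (1 : Gal(N/K)), v (π - σ π) = (b + 1 : ℤ) := fun σ hσ =>
      S.map_gal_sub_gal (τ := σ) (Finset.ne_of_mem_erase hσ).symm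
    rw [map_prod_eq_coe hsub, Finset.card_erase_of_mem (Finset.mem_univ _), card_univ_gal, hd]
  obtain ⟨P, hP, hPρ⟩ := S.exists_aeval_eq (ρ * D)
  have hv : v (aeval π P) = (1 * (c + (d - 1) * (b + 1)) : ℤ) := by
    rw [hPρ, one_mul, map_mul_eq_coe hρ hD]
  have hmod : ((finrank K N - 1 : ℕ) : ℤ) ≡ c + (d - 1) * (b + 1) [ZMOD d] := by
    rw [hd]
    calc d - 1 ≡ d - 1 + d * b [ZMOD d] := Int.modEq_iff_add_fac.2 ⟨b, rfl⟩
      _ = b + (d - 1) * (b + 1) := by ring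
      _ ≡ c + (d - 1) * (b + 1) [ZMOD d] := hc.symm.add_right _
  rw [← mul_div_cancel_right₀ ρ (ne_zero_of_map_eq_coe hD), ← hPρ,
    trace_aeval_div_prod_sub S.gal_injective hP,
    S.map_coeff_eq hP hv (Nat.sub_one_lt finrank_pos.ne') hmod, hd]
  ring_nf

theorem exists_map_intermediateField (S : HasSingleBreak K v π b) (E : IntermediateField K N)
    {a : E} (ha : a ≠ 0) : ∃ t : ℤ, v (algebraMap E N a) = (finrank E N * t : ℤ) := by
  obtain ⟨c, hc⟩ := exists_map_eq_coe v ((map_ne_zero (algebraMap E N)).2 ha)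
  obtain ⟨t, ht⟩ := S.exists_map_algebraMap (Algebra.norm K a) (Algebra.norm_ne_zero_iff.2 ha)
  refine ⟨t, hc.trans (WithTop.coe_inj.2 ?_)⟩
  have hprod : v (algebraMap K N (Algebra.norm K (algebraMap E N a))) = (finrank K N * c : ℤ) := by
    rw [Algebra.norm_eq_prod_automorphisms,
      map_prod_eq_coe fun σ _ => (S.map_gal σ _).trans hc, card_univ_gal]
  rw [← Algebra.norm_norm (S := E), Algebra.norm_algebraMap, map_pow, map_pow,
    map_pow_eq_coe ht, WithTop.coe_inj] at hprod
  refine mul_left_cancel₀ (Nat.cast_ne_zero.2 (finrank_pos (R := K) (M := N)).ne') ?_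
  rw [← hprod]
  ring

theorem restrictScalars (S : HasSingleBreak K v π b) (E : IntermediateField K N) :
    HasSingleBreak E v π b where
  pos := S.pos
  map_uniformizer := S.map_uniformizer
  exists_map_algebraMap a ha := by
    simpa only [one_mul] using S.exists_map_intermediateField E ha
  map_gal σ x := S.map_gal (σ.restrictScalars K) x
  map_gal_sub σ hσ := S.map_gal_sub (σ.restrictScalars K)
    ((AlgEquiv.restrictScalars_injective K).ne hσ)

theorem map_finrank (S : HasSingleBreak K v π b) (hb : (finrank K N : ℤ) ∣ b) :
    v (finrank K N : N) = ((finrank K N - 1) * b : ℤ) := by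
  have h := S.map_trace v.map_one (Int.modEq_of_dvd (by rwa [sub_zero]))
  rwa [← map_one (algebraMap K N), Algebra.trace_algebraMap, nsmul_one, map_natCast, zero_add] at h

theorem map_finrank_intermediateField (S : HasSingleBreak K v π b) (L : IntermediateField K N)
    (hb : (finrank K L : ℤ) ∣ b) :
    v (finrank K L : N) = (finrank L N * ((finrank K L - 1) * b) : ℤ) := by
  set θ := Algebra.trace L N (π ^ b) with hθdef
  have hπb : v (π ^ b) = b := by
    simpa only [mul_one] using map_zpow_eq_coe S.map_uniformizer b
  have hθ : v (algebraMap L N θ) = (finrank L N * b : ℤ) := by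
    rw [hθdef, (S.restrictScalars L).map_trace hπb rfl]
    ring_nf
  have hθ0 : θ ≠ 0 := (map_ne_zero (algebraMap L N)).1 (ne_zero_of_map_eq_coe hθ)
  have htrL : Algebra.trace L N (π ^ b / algebraMap L N θ) = 1 := by
    rw [div_eq_inv_mul, ← map_inv₀, ← Algebra.smul_def, map_smul, smul_eq_mul,
      inv_mul_cancel₀ hθ0]
  have htrK : Algebra.trace K N (π ^ b / algebraMap L N θ) = finrank K L := by
    rw [← Algebra.trace_trace (S := L), htrL, ← map_one (algebraMap K L),
      Algebra.trace_algebraMap, nsmul_one]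
  have hmod : b - finrank L N * b ≡ b [ZMOD finrank K N] := by
    obtain ⟨k, hk⟩ := hb
    refine Int.modEq_iff_add_fac.2 ⟨k, ?_⟩
    rw [← finrank_mul_finrank K L N]
    push_cast
    linear_combination (finrank L N : ℤ) * hk
  have h := S.map_trace (map_div_eq_coe hπb hθ) hmod
  rw [htrK, map_natCast, ← finrank_mul_finrank K L N] at h
  exact h.trans (WithTop.coe_inj.2 (by push_cast; ring))

theorem not_dvd_break (S : HasSingleBreak K v π b) {p n : ℕ} [hp : Fact p.Prime]
    (hvp : 0 < v (p : N)) (hK : finrank K N = p ^ n) (hn : 1 < n) : ¬ (p : ℤ) ∣ b := by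
  intro hpb
  obtain ⟨E, hE⟩ := exists_intermediateField_finrank_eq hK hn.le
  obtain ⟨L, hL⟩ := exists_intermediateField_finrank_eq hK (n.sub_le 1)
  rw [pow_one] at hE
  have hpL : finrank K L = p := by
    refine Nat.eq_of_mul_eq_mul_right (finrank_pos (R := L) (M := N)) ?_
    rw [finrank_mul_finrank, hL, hK, ← pow_succ', Nat.sub_add_cancel hn.le]
  have hvE : v (p : N) = ((p - 1) * b : ℤ) :=
    hE ▸ (S.restrictScalars E).map_finrank (hE ▸ hpb)
  have hvL : v (p : N) = (finrank L N * ((p - 1) * b) : ℤ) :=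
    hpL ▸ S.map_finrank_intermediateField L (hpL ▸ hpb)
  rw [hvE, ← WithTop.coe_zero, WithTop.coe_lt_coe] at hvp
  have hq : (finrank L N : ℤ) = 1 :=
    mul_right_cancel₀ hvp.ne' (by rw [one_mul, WithTop.coe_inj.1 (hvL.symm.trans hvE)])
  exact (Nat.one_lt_pow (Nat.sub_ne_zero_of_lt hn) hp.out.one_lt).ne'
    (hL.symm.trans (by exact_mod_cast hq))

theorem exists_isTotallyRamified_intermediateField (S : HasSingleBreak K v π b)
    (L : IntermediateField K N) [Normal K L] {τ : Gal(N/K)} (hτ : τ ∉ L.fixingSubgroup) :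
    ∃ P : L, IsTotallyRamified K (v.comap (algebraMap L N)) P (finrank L N) ∧
      v.comap (algebraMap L N) (τ.restrictNormal L P - P) = (finrank L N * (b + 1) : ℤ) := by
  -- With `f` the minimal polynomial of `π` over `L`, the uniformizer of `L` is `f(0)`. Its
  -- difference with its `τ`-conjugate is the constant coefficient of `τ f - f`, which is determined
  -- by the value of `τ f - f` at `π`.
  obtain ⟨f, hmonic, hdeg, hf⟩ := exists_monic_aeval_eq_prod_sub L π
  have hvf : ∀ (x : N) (c : ℤ), (∀ σ : Gal(N/L), v (x - σ π) = c) →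
      v (aeval x f) = (finrank L N * c : ℤ) := by
    intro x c hc
    rw [hf, map_prod_eq_coe fun σ _ => hc σ, card_univ_gal]
  have hvP : v (algebraMap L N (f.coeff 0)) = (finrank L N : ℤ) := by
    rw [coeff_zero_eq_aeval_zero', hvf 0 1 fun σ => ?_, mul_one]
    rw [zero_sub, v.map_neg, (S.restrictScalars L).map_gal, S.map_uniformizer]
  set fτ := f.map (τ.restrictNormal L : L →+* L)
  have hfτ : v (aeval π (fτ - f)) = (1 * (finrank L N * (b + 1)) : ℤ) := by
    have hπ : aeval π f = 0 := (hf π).trans (Finset.prod_eq_zero (Finset.mem_univ 1) (sub_self π))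
    rw [map_sub, hπ, sub_zero, ← τ.apply_symm_apply π, aeval_map_restrictNormal, S.map_gal, one_mul]
    refine hvf _ _ fun σ => S.map_gal_sub_gal (σ := τ⁻¹) (τ := σ.restrictScalars K) fun h => hτ ?_
    rw [← inv_mem_iff, h]
    exact fun x => σ.commutes x
  have hdegτ : (fτ - f).degree < finrank L N := by
    rw [← hdeg, ← degree_map f (τ.restrictNormal L : L →+* L)]
    refine degree_sub_lt_left (degree_map _ _) (hmonic.map _).ne_zero ?_
    rw [(hmonic.map _).leadingCoeff, hmonic.leadingCoeff]
  refine ⟨f.coeff 0, ⟨Nat.cast_pos.2 finrank_pos, hvP, fun a ha => ?_⟩, ?_⟩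
  · obtain ⟨t, ht⟩ := S.exists_map_algebraMap a ha
    refine ⟨t, ht.trans (WithTop.coe_inj.2 ?_)⟩
    rw [← finrank_mul_finrank K L N]
    push_cast
    ring
  · have h := (S.restrictScalars L).map_coeff_eq hdegτ hfτ finrank_pos
      (Int.modEq_of_dvd ⟨b + 1, by ring⟩)
    rw [coeff_sub, coeff_map, Nat.cast_zero, sub_zero, one_mul] at h
    exact h

variable {p : ℕ} [Fact p.Prime]

theorem exists_mem_map_eq_finrank_mul_of_mem_intermediateField (S : HasSingleBreak K v π b)
    (hvp : 0 < v (p : N)) (hpb : ¬ (p : ℤ) ∣ b) {L : IntermediateField K N} [Normal K L]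
    (hL : finrank K L = p) {W : Submodule K N} (hW : ∀ σ : Gal(N/K), ∀ y ∈ W, σ y ∈ W)
    {x : N} (hxW : x ∈ W) (hxL : x ∈ L) (hx : x ≠ 0) :
    ∃ z ∈ W, ∃ m : ℤ, v z = (finrank K N * m : ℤ) := by
  obtain ⟨τ, hτ⟩ : ∃ τ, τ ∉ L.fixingSubgroup := by
    by_contra! h
    rw [IntermediateField.finrank_eq_fixingSubgroup_index, (Subgroup.eq_top_iff' _).2 h,
      Subgroup.index_top] at hL
    exact (Fact.out : p.Prime).one_lt.ne hL
  have hb : 0 < b := lt_of_le_of_ne (S.break_nonneg (ne_of_mem_of_not_mem (one_mem _) hτ).symm)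
    fun h => hpb (h ▸ dvd_zero _)
  obtain ⟨P, hP, hτP⟩ := S.exists_isTotallyRamified_intermediateField L hτ
  have hvpL : 0 < v.comap (algebraMap L N) (p : L) := by
    change 0 < v (algebraMap L N p)
    rwa [map_natCast]
  have hstable : ∀ y ∈ W.comap L.val.toLinearMap,
      τ.restrictNormal L y ∈ W.comap L.val.toLinearMap := fun y hy => by
    change algebraMap L N (τ.restrictNormal L y) ∈ W
    rw [τ.restrictNormal_commutes]
    exact hW τ _ hy
  have hbot : W.comap L.val.toLinearMap ≠ ⊥ := fun h =>
    hx (congrArg Subtype.val ((Submodule.eq_bot_iff _).1 h ⟨x, hxL⟩ hxW))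
  obtain ⟨z, hz, m, hm⟩ := hP.exists_mem_map_eq_prime_mul_of_stable hL hvpL hb hpb hτP hstable hbot
  refine ⟨z, hz, m, hm.trans (WithTop.coe_inj.2 ?_)⟩
  rw [← finrank_mul_finrank K L N, hL]
  push_cast
  ring

theorem exists_mem_map_eq_finrank_mul_of_mem_fixedField (S : HasSingleBreak K v π b)
    (hvp : 0 < v (p : N)) (hpb : ¬ (p : ℤ) ∣ b) {H : Subgroup Gal(N/K)} [H.Normal]
    (hH : H.index ∣ p) {W : Submodule K N} (hW : ∀ σ : Gal(N/K), ∀ y ∈ W, σ y ∈ W)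
    {x : N} (hxW : x ∈ W) (hxH : x ∈ IntermediateField.fixedField H) (hx : x ≠ 0) :
    ∃ z ∈ W, ∃ m : ℤ, v z = (finrank K N * m : ℤ) := by
  have hfin : finrank K (IntermediateField.fixedField H) = H.index := by
    rw [IntermediateField.finrank_eq_fixingSubgroup_index,
      IntermediateField.fixingSubgroup_fixedField]
  rcases (Nat.dvd_prime (Fact.out : p.Prime)).1 hH with h1 | hp
  · rw [IntermediateField.finrank_eq_one_iff.1 (hfin.trans h1)] at hxH
    obtain ⟨a, rfl⟩ := hxH
    obtain ⟨t, ht⟩ := S.exists_map_algebraMap a fun h => hx (by rw [h, map_zero])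
    exact ⟨_, hxW, t, ht.trans (by rw [one_mul])⟩
  · exact S.exists_mem_map_eq_finrank_mul_of_mem_intermediateField hvp hpb (hfin.trans hp)
      hW hxW hxH hx

theorem exists_mem_map_eq_finrank_mul_of_ne_bot [CharZero N] (S : HasSingleBreak K v π b)
    (hvp : 0 < v (p : N)) (hpb : ¬ (p : ℤ) ∣ b) {n : ℕ}
    (φ : Gal(N/K) ≃* Multiplicative (Fin n → ZMod p)) {W : Submodule K N}
    (hW : ∀ σ : Gal(N/K), ∀ y ∈ W, σ y ∈ W) (hW0 : W ≠ ⊥) :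
    ∃ z ∈ W, ∃ m : ℤ, v z = (finrank K N * m : ℤ) := by
  classical
  obtain ⟨y, hyW, hy⟩ := W.exists_mem_ne_zero_of_ne_bot hW0
  obtain ⟨χ, hχ⟩ := exists_hom_sum_ker_ne_zero φ (f := fun σ => σ y) hy
  have hindex : χ.ker.index ∣ p := by
    rw [Subgroup.index_ker]
    simpa using χ.range.card_subgroup_dvd_card
  exact S.exists_mem_map_eq_finrank_mul_of_mem_fixedField hvp hpb hindex hW
    (x := ∑ σ : χ.ker, (σ : Gal(N/K)) y)
    (W.sum_mem fun σ _ => hW σ y hyW) (sum_apply_mem_fixedField χ.ker y) hχ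

end HasSingleBreak

end SingleBreak

section Padic

variable {p : ℕ} [Fact p.Prime] {N : Type*} [Field N] [Algebra ℚ_[p] N] [FiniteDimensional ℚ_[p] N]
  {x y : N}

variable (p N) in
/-- The multiplicative valuation of `N` attached to the maximal ideal of its ring of integers. -/
noncomputable abbrev adicValuation : Valuation N (WithZero (Multiplicative ℤ)) :=
  (IsDiscreteValuationRing.maximalIdeal (integers p N)).valuation N

theorem adicValuation_le_one_iff_isIntegral : adicValuation p N x ≤ 1 ↔ IsIntegral ℤ_[p] x := by
  refine ⟨fun h => ?_, fun h => IsDedekindDomain.HeightOneSpectrum.valuation_le_one _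
    (⟨x, h⟩ : integers p N)⟩
  obtain ⟨y, rfl⟩ := IsDiscreteValuationRing.exists_lift_of_le_one h
  exact y.2

theorem adicValuation_le_iff_spectralNorm_le :
    adicValuation p N x ≤ adicValuation p N y ↔
      spectralNorm ℚ_[p] N x ≤ spectralNorm ℚ_[p] N y := by
  by_cases hy : y = 0
  · rw [hy, map_zero, spectralNorm_zero, le_zero_iff, map_eq_zero]
    refine ⟨fun h => by rw [h, spectralNorm_zero], fun h => ?_⟩
    exact eq_zero_of_map_spectralNorm_eq_zero (h.antisymm (spectralNorm_nonneg x))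
      (Algebra.IsAlgebraic.isAlgebraic x)
  · rw [← div_le_one₀ (zero_lt_iff.2 ((map_ne_zero _).2 hy)), ← map_div₀,
      adicValuation_le_one_iff_isIntegral, isIntegral_iff_spectralNorm_le_one,
      ← div_le_one₀ (spectralNorm_zero_lt hy (Algebra.IsAlgebraic.isAlgebraic y))]
    simp only [← spectralMulAlgNorm_def, map_div₀]

theorem val_eq_neg_log (hx : x ≠ 0) :
    val p N x = ((-WithZero.log (adicValuation p N x) : ℤ) : WithTop ℤ) :=
  if_neg hx

theorem val_zero : val p N (0 : N) = ⊤ :=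
  if_pos rfl

theorem val_le_val_iff_adicValuation_le :
    val p N x ≤ val p N y ↔ adicValuation p N y ≤ adicValuation p N x := by
  by_cases hy : y = 0
  · simp [hy, val_zero]
  by_cases hx : x = 0
  · simp [hx, val_zero, hy, val_eq_neg_log hy]
  rw [val_eq_neg_log hx, val_eq_neg_log hy, WithTop.coe_le_coe, neg_le_neg_iff,
    WithZero.log_le_log ((map_ne_zero _).2 hy) ((map_ne_zero _).2 hx)]

theorem val_add (x y : N) : min (val p N x) (val p N y) ≤ val p N (x + y) := by
  simpa only [min_le_iff, val_le_val_iff_adicValuation_le, le_max_iff] using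
    (adicValuation p N).map_add x y

theorem val_mul (x y : N) : val p N (x * y) = val p N x + val p N y := by
  by_cases hx : x = 0
  · rw [hx, zero_mul, val_zero, WithTop.top_add]
  by_cases hy : y = 0
  · rw [hy, mul_zero, val_zero, WithTop.add_top]
  rw [val_eq_neg_log hx, val_eq_neg_log hy, val_eq_neg_log (mul_ne_zero hx hy), map_mul,
    WithZero.log_mul ((map_ne_zero _).2 hx) ((map_ne_zero _).2 hy), neg_add, WithTop.coe_add]

variable (p N) in
/-- `val p N` bundled as an additive valuation. -/
noncomputable def addVal : AddValuation N (WithTop ℤ) :=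
  .of (val p N) val_zero (by simp [val]) val_add val_mul

theorem addVal_le_iff_spectralNorm_le :
    addVal p N x ≤ addVal p N y ↔ spectralNorm ℚ_[p] N y ≤ spectralNorm ℚ_[p] N x :=
  val_le_val_iff_adicValuation_le.trans adicValuation_le_iff_spectralNorm_le

theorem addVal_eq_iff_spectralNorm_eq :
    addVal p N x = addVal p N y ↔ spectralNorm ℚ_[p] N x = spectralNorm ℚ_[p] N y := by
  simp only [le_antisymm_iff, addVal_le_iff_spectralNorm_le, and_comm]

theorem addVal_natCast_prime_pos : 0 < addVal p N (p : N) := by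
  rw [← (addVal p N).map_one, lt_iff_not_ge, addVal_le_iff_spectralNorm_le, spectralNorm_one,
    ← map_natCast (algebraMap ℚ_[p] N), spectralNorm_extends, not_le]
  exact Padic.norm_p_lt_one

variable (p N) in
theorem exists_addVal_eq_one : ∃ ϖ : N, addVal p N ϖ = (1 : ℤ) := by
  obtain ⟨ϖ, h⟩ := (IsDiscreteValuationRing.maximalIdeal
    (integers p N)).valuation_exists_uniformizer N
  have h0 : ϖ ≠ 0 := by
    rintro rfl
    exact WithZero.exp_ne_zero (h.symm.trans (map_zero _))
  refine ⟨ϖ, (val_eq_neg_log h0).trans ?_⟩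
  rw [adicValuation, h, WithZero.log_exp, neg_neg]

variable {K : Type*} [Field K] [Algebra K N]

theorem ramificationGroup_antitone (π : N) : Antitone (ramificationGroup p K π) :=
  fun i j hij σ (hσ : ((j + 1 : ℤ) : WithTop ℤ) ≤ val p N (σ π - π)) =>
    (WithTop.coe_le_coe.2 (by lia : i + 1 ≤ j + 1)).trans hσ

theorem mem_ramificationGroup_iff {π : N} {σ : Gal(N/K)} {c i : ℤ}
    (hc : addVal p N (σ π - π) = c) : σ ∈ ramificationGroup p K π i ↔ i + 1 ≤ c := by
  rw [← WithTop.coe_le_coe, ← hc]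
  rfl

variable [Algebra ℚ_[p] K] [IsScalarTower ℚ_[p] K N]

theorem addVal_gal (σ : Gal(N/K)) (x : N) : addVal p N (σ x) = addVal p N x :=
  addVal_eq_iff_spectralNorm_eq.2 (spectralNorm_eq_of_equiv (σ.restrictScalars ℚ_[p]) x).symm

variable [FiniteDimensional ℚ_[p] K]

theorem addVal_algebraMap_eq_iff {a c : K} :
    addVal p N (algebraMap K N a) = addVal p N (algebraMap K N c) ↔
      addVal p K a = addVal p K c := by
  simp only [addVal_eq_iff_spectralNorm_eq, ← spectralNorm.eq_of_tower]

theorem isTotallyRamified_addVal (hram : IsFullyRamified p K N) {π : N} (hπ : val p N π = 1) :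
    IsTotallyRamified K (addVal p N) π 1 where
  pos := one_pos
  map_uniformizer := hπ
  exists_map_algebraMap a ha := by
    obtain ⟨ϖ, hϖ⟩ := exists_addVal_eq_one p K
    obtain ⟨t, ht⟩ := exists_map_eq_coe (addVal p K) ha
    have hϖt : addVal p K a = addVal p K (ϖ ^ t) := by
      rw [ht, map_zpow_eq_coe hϖ, mul_one]
    refine ⟨t, ?_⟩
    rw [addVal_algebraMap_eq_iff.2 hϖt, map_zpow₀, map_zpow_eq_coe (hram ϖ hϖ)]
    ring_nf

theorem hasSingleBreak_addVal (hram : IsFullyRamified p K N) {π : N} (hπ : val p N π = 1) {b : ℤ}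
    (hb : lowerBreaks p K π = {b}) : HasSingleBreak K (addVal p N) π b where
  toIsTotallyRamified := isTotallyRamified_addVal hram hπ
  map_gal := addVal_gal
  map_gal_sub σ hσ := by
    have : FiniteDimensional K N := FiniteDimensional.right ℚ_[p] K N
    have hne : σ π - π ≠ 0 := sub_ne_zero.2 fun h =>
      hσ ((isTotallyRamified_addVal hram hπ).gal_injective h)
    obtain ⟨c, hc⟩ := exists_map_eq_coe (addVal p N) hne
    have hc1 : 1 ≤ c := by
      have h := (addVal p N).map_sub (σ π) π
      rw [addVal_gal, min_self, hc] at h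
      exact WithTop.coe_le_coe.1 (hπ.ge.trans h)
    have hmem : c - 1 ∈ lowerBreaks p K π := by
      refine ⟨by lia, ramificationGroup_antitone π (Int.le_add_one le_rfl), fun hsub => ?_⟩
      have h := hsub ((mem_ramificationGroup_iff hc).2 (sub_add_cancel c 1).le)
      rw [mem_ramificationGroup_iff hc] at h
      lia
    rw [hb, Set.mem_singleton_iff] at hmem
    rw [hc, ← hmem, sub_add_cancel]

end Padic

end LocalNormalBasis

open LocalNormalBasis Module in
theorem corollary4_general {K N : Type*} [Field K] [Field N] [Algebra K N] [FiniteDimensional K N]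
    [IsGalois K N] [CharZero N] {p n : ℕ} [Fact p.Prime] (hn : 1 < n)
    (hG : Nonempty (Gal(N/K) ≃* Multiplicative (Fin n → ZMod p)))
    {v : AddValuation N (WithTop ℤ)} (hvp : 0 < v (p : N)) {π : N} {b : ℤ}
    (S : HasSingleBreak K v π b) {ρ : N} {c : ℤ} (hρ : v ρ = c) (hc : c ≡ b [ZMOD (p : ℤ) ^ n]) :
    GeneratesNormalBasis K ρ := by
  obtain ⟨φ⟩ := hG
  have hK : finrank K N = p ^ n := by
    rw [← IsGalois.card_aut_eq_finrank, Nat.card_congr φ.toEquiv]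
    simp
  let W : Submodule K N := ⨅ σ : Gal(N/K), LinearMap.ker (Algebra.traceForm K N ρ ∘ₗ σ.toLinearMap)
  have hmem : ∀ y, y ∈ W ↔ ∀ σ : Gal(N/K), Algebra.trace K N (ρ * σ y) = 0 := fun y => by
    simp [W]
  have hW : ∀ σ : Gal(N/K), ∀ y ∈ W, σ y ∈ W := fun σ y hy =>
    (hmem _).2 fun τ => (hmem y).1 hy (τ * σ)
  refine generatesNormalBasis_of_forall_trace fun y hy => by_contra fun hy0 => ?_
  obtain ⟨z, hz, m, hm⟩ := S.exists_mem_map_eq_finrank_mul_of_ne_bot hvp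
    (S.not_dvd_break hvp hK hn) φ hW fun h => hy0 ((Submodule.eq_bot_iff W).1 h y ((hmem y).2 hy))
  have htrace := S.map_trace (map_mul_eq_coe hρ hm) (by
    rw [hK]
    push_cast
    rwa [Int.add_modulus_mul_modEq_iff])
  have hz1 : Algebra.trace K N (ρ * z) = 0 := (hmem z).1 hz 1
  exact ne_zero_of_map_eq_coe htrace (by rw [hz1, map_zero])

open LocalNormalBasis in
theorem corollary4 (p : ℕ) [Fact p.Prime]
    (K N : Type*) [Field K] [Algebra ℚ_[p] K] [FiniteDimensional ℚ_[p] K]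
    [Field N] [Algebra ℚ_[p] N] [FiniteDimensional ℚ_[p] N]
    [Algebra K N] [IsScalarTower ℚ_[p] K N] [IsGalois K N]
    (n : ℕ) (hn : 1 < n)
    (hG : Nonempty (Gal(N/K) ≃* Multiplicative (Fin n → ZMod p)))
    (hram : IsFullyRamified p K N)
    (π : N) (hπ : val p N π = 1)
    (b : ℤ) (hb : lowerBreaks p K π = {b})
    (ρ : N) (v : ℤ) (hv : val p N ρ = v) (hρ : v ≡ b [ZMOD (p : ℤ) ^ n]) :
    GeneratesNormalBasis K ρ := by
  have : FiniteDimensional K N := FiniteDimensional.right ℚ_[p] K N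
  have : CharZero N := charZero_of_injective_algebraMap (algebraMap ℚ_[p] N).injective
  exact corollary4_general hn hG addVal_natCast_prime_pos (hasSingleBreak_addVal hram hπ hb) hv hρ
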